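/- Let $\mathcal A$ be an arrangement of $n$ distinct lines in the complex projective plane $\mathbb P^2$, with defining polynomial $Q=L_1\cdots L_n\in R=\mathbb C[x,y,z]$, where $L_1,\dots,L_n$ are linear forms defining the lines. Assume that $\mathcal A$ is essential, i.e. no point of $\mathbb P^2$ lies on all the lines, and that $\mathcal A$ is not the union of $n-1$ lines through a common point and one line that does not pass through that point. Let $J_Q=\langle \partial Q/\partial x,\partial Q/\partial y,\partial Q/\partial z\rangle\subset R$ be the Jacobian ideal of $Q$, and let $\deg(\sqrt{J_Q})$ be the degree of the subscheme of $\mathbb P^2$ defined by the radical of $J_Q$, i.e. the normalized leading coefficient of the Hilbert polynomial of $R/\sqrt{J_Q}$ ($e!$ times the leading coefficient, where $e$ is the degree of the polynomial). If $$\deg(\sqrt{J_Q})\ \ge\ n^2-5n+8,$$ then $\mathcal A$ is not free, i.e. the $R$-module $D(\mathcal A)=\{\theta\in \mathrm{Der}_{\mathbb C}(R) : \theta(Q)\in\langle Q\rangle\}$ is not free. -/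

import Mathlib

noncomputable section

/-- The ring `R = ℂ[x, y, z]`. -/
abbrev PolyRing : Type := MvPolynomial (Fin 3) ℂ

/-- The Hilbert function of `R / I`: in degree `k` it is the dimension over `ℂ` of
`R_k / (I ∩ R_k)`, where `R_k` is the space of homogeneous polynomials of degree `k`.
For a homogeneous ideal `I` this is the dimension of the graded piece `(R / I)_k`. -/
def hilbertFunction (I : Ideal PolyRing) (k : ℕ) : ℕ :=
  Module.finrank ℂ
    (MvPolynomial.homogeneousSubmodule (Fin 3) ℂ k ⧸
      (I.restrictScalars ℂ).comap (MvPolynomial.homogeneousSubmodule (Fin 3) ℂ k).subtype)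

/-- `P` is the Hilbert polynomial of `R / I`: it agrees with the Hilbert function in all large
degrees. -/
def IsHilbertPolynomial (I : Ideal PolyRing) (P : Polynomial ℚ) : Prop :=
  ∀ᶠ k : ℕ in Filter.atTop, (hilbertFunction I k : ℚ) = P.eval (k : ℚ)

/-- A Hilbert polynomial is unique. -/
theorem IsHilbertPolynomial.unique {I : Ideal PolyRing} {P P' : Polynomial ℚ}
    (h : IsHilbertPolynomial I P) (h' : IsHilbertPolynomial I P') : P = P' := by
  obtain ⟨N, hN⟩ := Filter.eventually_atTop.1 (h.and h')
  refine Polynomial.eq_of_infinite_eval_eq P P' ?_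
  refine Set.Infinite.mono (s := (fun k : ℕ => (k : ℚ)) '' Set.Ici N) ?_
    ((Set.Ici_infinite N).image Nat.cast_injective.injOn)
  rintro _ ⟨k, hk, rfl⟩
  exact (hN k hk).1.symm.trans (hN k hk).2

open Classical in
/-- The Hilbert polynomial of `R / I`. By the Hilbert–Serre theorem it exists for every homogeneous
ideal `I`; the value `0` for other ideals is only a convention. -/
def hilbertPolynomial (I : Ideal PolyRing) : Polynomial ℚ :=
  if h : ∃ P, IsHilbertPolynomial I P then h.choose else 0

/-- The degree `deg I` of (the projective scheme in `ℙ²` defined by) a homogeneous ideal `I`: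
`e!` times the leading coefficient of the Hilbert polynomial of `R / I`, where `e` is the degree of
that polynomial. For a scheme of dimension zero this is the constant value of the Hilbert
polynomial. -/
def idealDegree (I : Ideal PolyRing) : ℚ :=
  ((hilbertPolynomial I).natDegree.factorial : ℚ) * (hilbertPolynomial I).leadingCoeff

/-- An arrangement of `n` (distinct) lines in the complex projective plane `ℙ²`, equivalently of `n`
planes through the origin in `ℂ³`, given by fixed defining linear forms
`L_i = a_i x + b_i y + c_i z`, where `coeff i = (a_i, b_i, c_i)`. -/
structure LineArrangement (n : ℕ) where
  /-- The coefficient vectors of the defining linear forms. -/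
  coeff : Fin n → Fin 3 → ℂ
  /-- Each `L_i` is a nonzero linear form, so that it defines a line. -/
  coeff_ne_zero : ∀ i, coeff i ≠ 0
  /-- The lines are distinct: no two of the forms are proportional. -/
  not_proportional : ∀ i j, i ≠ j → ∀ c : ℂ, coeff i ≠ c • coeff j

namespace LineArrangement

variable {n : ℕ} (A : LineArrangement n)

/-- The point with homogeneous coordinates `p` (for `p ≠ 0`) lies on the `i`-th line. -/
def PassesThrough (i : Fin n) (p : Fin 3 → ℂ) : Prop :=
  ∑ j, A.coeff i j * p j = 0

/-- The linear form `L_i = a_i x + b_i y + c_i z`. -/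
def linearForm (i : Fin n) : PolyRing :=
  ∑ j, MvPolynomial.C (A.coeff i j) * MvPolynomial.X j

/-- The defining polynomial `Q = L_1 ⋯ L_n`. -/
def definingPolynomial : PolyRing :=
  ∏ i, A.linearForm i

/-- The Jacobian ideal `J_Q`, generated by the three partial derivatives of `Q`. -/
def jacobianIdeal : Ideal PolyRing :=
  Ideal.span (Set.range fun j : Fin 3 => MvPolynomial.pderiv j A.definingPolynomial)

/-- The arrangement is essential: the planes in `ℂ³` meet in the origin only, i.e. no point of
`ℙ²` lies on all the lines. -/
def IsEssential : Prop :=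
  ∀ p : Fin 3 → ℂ, (∀ i, A.PassesThrough i p) → p = 0

/-- The arrangement consists of a pencil of `n - 1` lines through a point `p` and one more line
that misses `p`. -/
def IsPencilPlusGenericLine : Prop :=
  ∃ (p : Fin 3 → ℂ) (i : Fin n), p ≠ 0 ∧ ¬ A.PassesThrough i p ∧
    ∀ j, j ≠ i → A.PassesThrough j p

/-- The `R`-module `D(𝒜)` of logarithmic derivations: all `θ ∈ Der_ℂ(R)` with `θ(Q) ∈ ⟨Q⟩`. -/
def logDerivations : Submodule PolyRing (Derivation ℂ PolyRing PolyRing) where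
  carrier := {θ | θ A.definingPolynomial ∈ Ideal.span {A.definingPolynomial}}
  zero_mem' := by simp
  add_mem' := fun {θ η} hθ hη => by
    have h := (Ideal.span {A.definingPolynomial}).add_mem (Set.mem_ofPred.1 hθ) (Set.mem_ofPred.1 hη)
    simpa using h
  smul_mem' := fun f θ hθ => by
    have h := (Ideal.span {A.definingPolynomial}).mul_mem_left f (Set.mem_ofPred.1 hθ)
    simpa using h

/-- The arrangement is free: `D(𝒜)` is a free `R`-module. -/
def IsFree : Prop :=
  Module.Free PolyRing A.logDerivations

end LineArrangement

end

open MvPolynomial Matrix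

/-! The radical of the Jacobian ideal cuts out the reduced set of singular points, and each of these
lies on two lines. So its degree is at most `n.choose 2`, and every coincidence among the pairwise
intersections lowers the bound. Compared with n² - 5n + 8 this forces n ≤ 6, while the hypotheses on
the arrangement force n ≥ 4. For n = 6 at least 14 of 15 points are needed, and a triple point costs
two, so the arrangement is generic. For n = 5 at least 8 of 10 are needed, so there is at most one
triple point. For n = 4 a concurrent triple would give a pencil plus a line.

These arrangements are not free by a degree argument. Freeness yields three independent homogeneous
logarithmic fields whose degrees sum to n (`exists_homogeneous_det_ne_zero`); essentiality makes the
degrees positive. A logarithmic field v is parallel to (x, y, z) at every intersection point. If v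
has degree d, the entries of (x, y, z) × v have degree d + 1, so they vanish on each line with more
than d + 1 intersection points (`linearForm_dvd_cross`), and identically once there are more than d
+ 1 such lines. Two radial fields are dependent, so at most one degree is small. In the generic case
the sum then exceeds n. With one triple point p the degrees must be 1, 2, 2, and then all three
fields lie in the plane spanned by p and (x, y, z). -/

/-! ### Linear forms, cross products and vanishing on lines -/

/-- The linear form with coefficient vector `a`. -/
noncomputable def linForm (a : Fin 3 → ℂ) : PolyRing := ∑ j, C (a j) * X j

/-- A vector of constants, as a vector of polynomials. -/
noncomputable def constVec (a : Fin 3 → ℂ) : Fin 3 → PolyRing := fun j => C (a j)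

/-- The vector `(x, y, z)` of the coordinates. -/
noncomputable def coordVec : Fin 3 → PolyRing := X

@[simp]
theorem eval_linForm (a x : Fin 3 → ℂ) : eval x (linForm a) = a ⬝ᵥ x := by
  simp [linForm, dotProduct]

theorem linForm_isHomogeneous (a : Fin 3 → ℂ) : (linForm a).IsHomogeneous 1 :=
  IsHomogeneous.sum _ _ _ fun _ _ => isHomogeneous_C_mul_X _ _

theorem linForm_injective : Function.Injective linForm := by
  intro a b h
  funext j
  have := congrArg (eval (Pi.single j 1)) h
  simpa using this

theorem linForm_ne_zero {a : Fin 3 → ℂ} (ha : a ≠ 0) : linForm a ≠ 0 := by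
  have h0 : linForm 0 = 0 := by simp [linForm]
  exact fun h => ha (linForm_injective (h.trans h0.symm))

theorem irreducible_linForm {a : Fin 3 → ℂ} (ha : a ≠ 0) : Irreducible (linForm a) := by
  refine irreducible_of_totalDegree_eq_one
    ((linForm_isHomogeneous a).totalDegree (linForm_ne_zero ha)) fun x hx => ?_
  rw [isUnit_iff_ne_zero]
  rintro rfl
  refine linForm_ne_zero ha ?_
  ext m
  simpa using hx m

/-- A linear form generates a prime ideal, which by the Nullstellensatz contains every polynomial
vanishing on its zero set. -/
theorem linForm_dvd_of_eval {a : Fin 3 → ℂ} (ha : a ≠ 0) {f : PolyRing}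
    (h : ∀ x, a ⬝ᵥ x = 0 → eval x f = 0) : linForm a ∣ f := by
  have hp : (Ideal.span {linForm a}).IsPrime :=
    (Ideal.span_singleton_prime (linForm_ne_zero ha)).2 (irreducible_linForm ha).prime
  rw [← Ideal.mem_span_singleton, ← IsPrime.vanishingIdeal_zeroLocus (K := ℂ)
    (Ideal.span {linForm a}), mem_vanishingIdeal_iff]
  intro x hx
  have := hx _ (Ideal.mem_span_singleton_self _)
  simp only [aeval_eq_eval] at this ⊢
  exact h x (by simpa using this)

theorem isRelPrime_linForm {a b : Fin 3 → ℂ} (h : a ⨯₃ b ≠ 0) :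
    IsRelPrime (linForm a) (linForm b) := by
  have ha : a ≠ 0 := by rintro rfl; simp at h
  have hb : b ≠ 0 := by rintro rfl; simp at h
  rw [(irreducible_linForm ha).isRelPrime_iff_not_dvd]
  intro hd
  obtain ⟨u, hu⟩ := (irreducible_linForm ha).associated_of_dvd (irreducible_linForm hb) hd
  obtain ⟨r, -, hr⟩ := isUnit_iff_eq_C_of_isReduced.1 u.isUnit
  apply h
  have : linForm b = linForm (r • a) := by
    rw [← hu, hr, linForm, linForm, Finset.sum_mul]
    exact Finset.sum_congr rfl fun j _ => by simp; ring
  rw [linForm_injective this]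
  simp

/-- A form of degree `d` divisible by more than `d` pairwise coprime linear forms is zero. -/
theorem eq_zero_of_linForm_dvd {ι : Type*} {S : Finset ι} {a : ι → Fin 3 → ℂ}
    (hS : ∀ i ∈ S, ∀ j ∈ S, i ≠ j → a i ⨯₃ a j ≠ 0) {d : ℕ}
    (hd : d < S.card) {f : PolyRing} (hf : f.IsHomogeneous d) (h : ∀ i ∈ S, linForm (a i) ∣ f) :
    f = 0 := by
  by_contra hf0
  have hdvd : ∏ i ∈ S, linForm (a i) ∣ f :=
    Finset.prod_dvd_of_isRelPrime (fun i hi j hj hij => isRelPrime_linForm (hS i hi j hj hij)) h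
  obtain ⟨g, rfl⟩ := hdvd
  have hg : g ≠ 0 := right_ne_zero_of_mul hf0
  have hp : ∏ i ∈ S, linForm (a i) ≠ 0 := left_ne_zero_of_mul hf0
  have h1 := hf.totalDegree hf0
  have h2 := (IsHomogeneous.prod S (fun i => linForm (a i)) (fun _ => 1)
    fun i _ => linForm_isHomogeneous _).totalDegree hp
  rw [totalDegree_mul_of_isDomain hp hg, h2] at h1
  simp at h1
  omega

theorem cross_eq_zero_of_cross_eq_zero {K : Type*} [CommRing K] [IsDomain K] {n x y : Fin 3 → K}
    (hn : n ≠ 0) (hx : n ⨯₃ x = 0) (hy : n ⨯₃ y = 0) : x ⨯₃ y = 0 := by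
  obtain ⟨j, hj⟩ := Function.ne_iff.1 hn
  have key : ∀ (m : Fin 3 → K), n ⨯₃ m = 0 → ∀ k, n j * m k = n k * m j := by
    intro m hm k
    have h0 := congrFun hm 0
    have h1 := congrFun hm 1
    have h2 := congrFun hm 2
    simp [cross_apply] at h0 h1 h2
    fin_cases j <;> fin_cases k <;> simp <;> grind
  have key2 : ∀ k l, x k * y l = x l * y k := by
    intro k l
    apply mul_left_cancel₀ (mul_ne_zero hj hj)
    linear_combination n j * y l * key x hx k + n k * x j * key y hy l - n j * y k * key x hx l
      - n l * x j * key y hy k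
  funext k
  fin_cases k <;> simp [cross_apply, key2]

theorem cross_eq_zero_of_dotProduct_eq_zero {K : Type*} [Field K] {a b x y : Fin 3 → K}
    (h : a ⨯₃ b ≠ 0) (hax : a ⬝ᵥ x = 0) (hbx : b ⬝ᵥ x = 0) (hay : a ⬝ᵥ y = 0) (hby : b ⬝ᵥ y = 0) :
    x ⨯₃ y = 0 := by
  refine cross_eq_zero_of_cross_eq_zero h ?_ ?_ <;>
  rw [cross_cross_eq_smul_sub_smul] <;> simp [hax, hbx, hay, hby]

/-- A form of degree `d` that vanishes on more than `d` distinct points of a line in `ℙ²` vanishes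
on the line. -/
theorem linForm_dvd_of_forall_inter {ι : Type*} {S : Finset ι} {a : Fin 3 → ℂ}
    {b : ι → Fin 3 → ℂ} (hS : ∀ i ∈ S, ∀ j ∈ S, i ≠ j → a ⬝ᵥ b i ⨯₃ b j ≠ 0)
    (h0 : ∀ i ∈ S, a ⨯₃ b i ≠ 0) (ha : a ≠ 0) {d : ℕ}
    (hd : d < S.card) {f : PolyRing} (hf : f.IsHomogeneous d)
    (h : ∀ i ∈ S, ∀ x, a ⬝ᵥ x = 0 → b i ⬝ᵥ x = 0 → eval x f = 0) :
    linForm a ∣ f := by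
  obtain ⟨q, hq⟩ : ∃ q, a ⬝ᵥ q = 1 := by
    obtain ⟨j, hj⟩ := Function.ne_iff.1 ha
    exact ⟨Pi.single j (a j)⁻¹, by simpa using mul_inv_cancel₀ hj⟩
  -- `g` is `f` composed with the projection along `q` onto the plane of `a`, so `g = 0` means that
  -- `f` vanishes on that plane.
  set g : PolyRing := aeval (fun j => X j - C (q j) * linForm a) f with hg
  have hgeval : ∀ x, eval x g = eval (x - (a ⬝ᵥ x) • q) f := by
    intro x
    rw [hg, ← aeval_eq_eval, ← aeval_eq_eval, ← AlgHom.comp_apply, comp_aeval]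
    congr 2
    funext j
    simp [aeval_eq_eval, mul_comm]
  have hg0 : g = 0 := by
    -- These are the forms `b i` composed with the same projection. They stay pairwise independent
    -- because the lines `b i` meet the line `a` in distinct points.
    refine eq_zero_of_linForm_dvd (S := S) (a := fun i => b i - (b i ⬝ᵥ q) • a) (d := d)
      ?_ hd ?_ ?_
    · intro i hi j hj hij h'
      apply hS i hi j hj hij
      have := congrArg (fun v => a ⬝ᵥ v) h'
      simpa [dotProduct_sub, sub_eq_add_neg] using this
    · have := hf.aeval (n := 1) (fun j => X j - C (q j) * linForm a)
        fun j => (isHomogeneous_X _ _).sub ((linForm_isHomogeneous a).C_mul _)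
      rwa [one_mul] at this
    · intro i hi
      apply linForm_dvd_of_eval
      · intro h'
        apply h0 i hi
        rw [sub_eq_zero.1 h']
        simp
      intro x hx
      rw [hgeval]
      apply h i hi
      · simp [dotProduct_sub, hq]
      · simp only [sub_dotProduct, smul_dotProduct, smul_eq_mul] at hx
        simp only [dotProduct_sub, dotProduct_smul, smul_eq_mul]
        linear_combination hx
  refine linForm_dvd_of_eval ha fun x hx => ?_
  have := hgeval x
  rw [hg0, hx] at this
  simpa using this.symm

/-! ### Determinants and homogeneous components -/

/-- If `l` divides the product of `a` with every row of a square matrix, then `l` divides the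
product of the determinant with each entry of `a`. -/
theorem dvd_det_mul_of_forall_dvd_dotProduct {R : Type*} [CommRing R] {m : Type*} [Fintype m]
    [DecidableEq m] (M : Matrix m m R) (a : m → R) (l : R) (h : ∀ k, l ∣ a ⬝ᵥ M k) (j : m) :
    l ∣ M.det * a j := by
  choose u hu using h
  have h1 : M *ᵥ a = l • u := by
    funext k
    simp [mulVec, dotProduct_comm _ a, hu]
  have h2 := congrArg (fun w => (M.adjugate *ᵥ w) j) h1
  simp only [mulVec_mulVec, adjugate_mul, smul_mulVec, one_mulVec, mulVec_smul] at h2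
  exact ⟨_, h2⟩

theorem linForm_dvd_det {a : Fin 3 → ℂ} (ha : a ≠ 0) (M : Matrix (Fin 3) (Fin 3) PolyRing)
    (h : ∀ k, linForm a ∣ constVec a ⬝ᵥ M k) : linForm a ∣ M.det := by
  obtain ⟨j, hj⟩ := Function.ne_iff.1 ha
  have := dvd_det_mul_of_forall_dvd_dotProduct M (constVec a) _ h j
  exact (((isUnit_iff_ne_zero.2 hj).map C).dvd_mul_right).1 this

attribute [local instance] MvPolynomial.gradedAlgebra in
theorem dvd_homogeneousComponent {f g : PolyRing} {m : ℕ} (hf : f.IsHomogeneous m) (h : f ∣ g)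
    (d : ℕ) : f ∣ homogeneousComponent d g := by
  rw [← Ideal.mem_span_singleton] at h ⊢
  refine homogeneousComponent_mem_of_mem (Ideal.homogeneous_span _ _ ?_) h d
  rintro x rfl
  exact ⟨m, hf⟩

theorem det_isHomogeneous (M : Matrix (Fin 3) (Fin 3) PolyRing) (d : Fin 3 → ℕ)
    (h : ∀ k j, (M k j).IsHomogeneous (d k)) : M.det.IsHomogeneous (d 0 + d 1 + d 2) := by
  have key : ∀ i j k, (M 0 i * M 1 j * M 2 k).IsHomogeneous (d 0 + d 1 + d 2) := fun i j k =>
    ((h 0 i).mul (h 1 j)).mul (h 2 k)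
  rw [det_fin_three]
  exact (((((key _ _ _).sub (key _ _ _)).sub (key _ _ _)).add (key _ _ _)).add (key _ _ _)).sub
    (key _ _ _)

/-! ### Logarithmic vector fields and Saito's criterion -/

namespace LineArrangement

variable {n : ℕ} (A : LineArrangement n)

theorem linearForm_eq (i : Fin n) : A.linearForm i = linForm (A.coeff i) := rfl

theorem cross_coeff_ne_zero {i j : Fin n} (hij : i ≠ j) : A.coeff i ⨯₃ A.coeff j ≠ 0 := by
  rw [crossProduct_ne_zero_iff_linearIndependent, LinearIndependent.pair_iff' (A.coeff_ne_zero i)]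
  exact fun c hc => A.not_proportional j i hij.symm c hc.symm

theorem irreducible_linearForm (i : Fin n) : Irreducible (A.linearForm i) :=
  irreducible_linForm (A.coeff_ne_zero i)

theorem isRelPrime_linearForm {i j : Fin n} (hij : i ≠ j) :
    IsRelPrime (A.linearForm i) (A.linearForm j) :=
  isRelPrime_linForm (A.cross_coeff_ne_zero hij)

/-- The product of all the linear forms but the `i`-th. -/
noncomputable def cofactor (i : Fin n) : PolyRing := ∏ j ∈ Finset.univ.erase i, A.linearForm j

theorem linearForm_mul_cofactor (i : Fin n) :
    A.linearForm i * A.cofactor i = A.definingPolynomial :=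
  Finset.mul_prod_erase _ _ (Finset.mem_univ i)

theorem not_linearForm_dvd_cofactor (i : Fin n) : ¬ A.linearForm i ∣ A.cofactor i := by
  intro h
  obtain ⟨j, hj, hd⟩ := ((A.irreducible_linearForm i).prime.dvd_finsetProd_iff _).1 h
  exact ((A.irreducible_linearForm i).isRelPrime_iff_not_dvd.1
    (A.isRelPrime_linearForm (Finset.ne_of_mem_erase hj).symm)) hd

theorem definingPolynomial_dvd {f : PolyRing} (h : ∀ i, A.linearForm i ∣ f) :
    A.definingPolynomial ∣ f :=
  Fintype.prod_dvd_of_isRelPrime (fun _ _ hij => A.isRelPrime_linearForm hij) h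

theorem definingPolynomial_ne_zero : A.definingPolynomial ≠ 0 :=
  Finset.prod_ne_zero_iff.2 fun i _ => (A.irreducible_linearForm i).ne_zero

theorem definingPolynomial_isHomogeneous : A.definingPolynomial.IsHomogeneous n := by
  have := IsHomogeneous.prod Finset.univ A.linearForm (fun _ => 1)
    fun i _ => linForm_isHomogeneous _
  rwa [Finset.sum_const, Finset.card_univ, Fintype.card_fin, smul_eq_mul, mul_one] at this

/-- The logarithmic vector fields: the vectors `v` such that the derivation `∑ v_j ∂_j` preserves
each of the lines. -/
def logVectors : Submodule PolyRing (Fin 3 → PolyRing) where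
  carrier := {v | ∀ i, A.linearForm i ∣ constVec (A.coeff i) ⬝ᵥ v}
  zero_mem' := by simp
  add_mem' := fun {v w} hv hw i => by
    rw [dotProduct_add]
    exact dvd_add (hv i) (hw i)
  smul_mem' := fun f v hv i => by
    rw [dotProduct_smul]
    exact (hv i).mul_left f

theorem mem_logVectors {v : Fin 3 → PolyRing} :
    v ∈ A.logVectors ↔ ∀ i, A.linearForm i ∣ constVec (A.coeff i) ⬝ᵥ v := Iff.rfl

theorem derivation_linearForm (θ : Derivation ℂ PolyRing PolyRing) (i : Fin n) :
    θ (A.linearForm i) = constVec (A.coeff i) ⬝ᵥ fun j => θ (X j) := by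
  simp [linearForm, dotProduct, constVec]

/-- By the Leibniz rule, θ(Q) is congruent to the cofactor times θ(L_i) modulo L_i, and the prime
L_i does not divide the cofactor. -/
theorem mem_logDerivations_iff (θ : Derivation ℂ PolyRing PolyRing) :
    θ ∈ A.logDerivations ↔ (fun j => θ (X j)) ∈ A.logVectors := by
  have key : ∀ i, A.linearForm i ∣ θ A.definingPolynomial ↔
      A.linearForm i ∣ constVec (A.coeff i) ⬝ᵥ fun j => θ (X j) := by
    intro i
    rw [← A.linearForm_mul_cofactor i, Derivation.leibniz, ← A.derivation_linearForm, smul_eq_mul,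
      smul_eq_mul, dvd_add_right (dvd_mul_right _ _), (A.irreducible_linearForm i).prime.dvd_mul]
    simp [A.not_linearForm_dvd_cofactor i]
  have hmem : θ ∈ A.logDerivations ↔ A.definingPolynomial ∣ θ A.definingPolynomial :=
    Ideal.mem_span_singleton
  rw [hmem, mem_logVectors]
  refine ⟨fun h i => (key i).1 (dvd_trans ?_ h), fun h => A.definingPolynomial_dvd fun i =>
    (key i).2 (h i)⟩
  exact Finset.dvd_prod_of_mem _ (Finset.mem_univ i)

/-- Logarithmic derivations and logarithmic vector fields are the same. -/
noncomputable def logDerivationsEquiv : A.logDerivations ≃ₗ[PolyRing] A.logVectors where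
  toFun θ := ⟨fun j => θ.1 (X j), (A.mem_logDerivations_iff θ.1).1 θ.2⟩
  map_add' _ _ := rfl
  map_smul' _ _ := rfl
  invFun v := ⟨mkDerivation ℂ v.1, (A.mem_logDerivations_iff _).2 (by simp)⟩
  left_inv θ := by
    ext j
    simp
  right_inv v := by
    ext j
    simp

theorem definingPolynomial_smul_mem (v : Fin 3 → PolyRing) :
    A.definingPolynomial • v ∈ A.logVectors := by
  intro i
  rw [dotProduct_smul, ← A.linearForm_mul_cofactor i]
  exact ((dvd_mul_right _ _).mul_right _)

/-- The module is squeezed between Q·R³ and R³. -/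
theorem finrank_logVectors : Module.finrank PolyRing A.logVectors = 3 := by
  refine le_antisymm ((Submodule.finrank_le _).trans_eq (by simp)) ?_
  have h := LinearMap.finrank_le_finrank_of_injective
    (f := (LinearMap.lsmul PolyRing (Fin 3 → PolyRing) A.definingPolynomial).codRestrict
      A.logVectors A.definingPolynomial_smul_mem) ?_
  · rwa [Module.finrank_fin_fun] at h
  · intro v w h
    have := congrArg Subtype.val h
    exact smul_right_injective _ A.definingPolynomial_ne_zero this

theorem definingPolynomial_dvd_det {M : Matrix (Fin 3) (Fin 3) PolyRing}
    (h : ∀ k, M k ∈ A.logVectors) : A.definingPolynomial ∣ M.det :=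
  A.definingPolynomial_dvd fun i => linForm_dvd_det (A.coeff_ne_zero i) M fun k => h k i

/-- With a_j ≠ 0, two rows are the cofactor times the constant fields a_j e_k - a_k e_j, which kill
L_i; row j is Q e_j. These test fields bound the determinant of a basis from above in the
divisibility order. -/
theorem exists_det_eq_cofactor_sq_mul (i : Fin n) :
    ∃ (M : Matrix (Fin 3) (Fin 3) PolyRing) (c : ℂ), c ≠ 0 ∧ (∀ k, M k ∈ A.logVectors) ∧
      M.det = A.definingPolynomial * (C c * A.cofactor i ^ 2) := by
  obtain ⟨j, hj⟩ := Function.ne_iff.1 (A.coeff_ne_zero i)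
  let a := A.coeff i
  let V : Fin 3 → Fin 3 → PolyRing := fun k =>
    A.cofactor i • (constVec a j • Pi.single k 1 - constVec a k • Pi.single j 1) +
      A.definingPolynomial • if k = j then Pi.single j 1 else 0
  have hV : ∀ k l, Matrix.of V k l = A.cofactor i * (C (a j) * (Pi.single k 1 : Fin 3 → PolyRing) l
      - C (a k) * (Pi.single j 1 : Fin 3 → PolyRing) l) +
      A.definingPolynomial * (if k = j then (Pi.single j 1 : Fin 3 → PolyRing) else 0) l :=
    fun _ _ => rfl
  refine ⟨Matrix.of V, a j ^ 2, pow_ne_zero 2 hj, fun k => ?_, ?_⟩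
  · refine Submodule.add_mem _ (fun l => ?_) (A.definingPolynomial_smul_mem _)
    simp only [dotProduct_smul, dotProduct_sub, dotProduct_single, mul_one, smul_eq_mul]
    by_cases hl : l = i
    · subst hl
      simp [a, mul_comm]
    · exact (Finset.dvd_prod_of_mem _ (Finset.mem_erase.2 ⟨hl, Finset.mem_univ l⟩)).mul_right _
  · rw [det_fin_three]
    simp only [hV]
    fin_cases j <;> simp <;> ring

/-- The determinant of a basis divides that of any three logarithmic fields. Hence its quotient by Q
divides the square of every cofactor, and the cofactors have no common irreducible factor. -/
theorem exists_basis_det (hfree : A.IsFree) (hn : 0 < n) :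
    ∃ (M : Matrix (Fin 3) (Fin 3) PolyRing) (c : ℂ), c ≠ 0 ∧ (∀ k, M k ∈ A.logVectors) ∧
      M.det = C c * A.definingPolynomial := by
  have : Module.Free PolyRing A.logDerivations := hfree
  have : Module.Free PolyRing A.logVectors := Module.Free.of_equiv A.logDerivationsEquiv
  let b := Module.finBasisOfFinrankEq PolyRing A.logVectors A.finrank_logVectors
  let M : Matrix (Fin 3) (Fin 3) PolyRing := fun k => (b k : Fin 3 → PolyRing)
  have hM : ∀ k, M k ∈ A.logVectors := fun k => (b k).2
  have hdvd : ∀ V : Matrix (Fin 3) (Fin 3) PolyRing, (∀ k, V k ∈ A.logVectors) → M.det ∣ V.det := by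
    intro V hV
    have : V = (Matrix.of fun k l => b.repr ⟨V k, hV k⟩ l) * M := by
      ext1 k j
      have := congrArg (fun w : A.logVectors => (w : Fin 3 → PolyRing) j)
        (b.sum_repr ⟨V k, hV k⟩)
      refine this.symm.trans ?_
      rw [Matrix.mul_apply]
      simp [-Module.Basis.sum_repr, M]
    rw [this, det_mul]
    exact dvd_mul_left _ _
  obtain ⟨g, hg⟩ := A.definingPolynomial_dvd_det hM
  have hg_dvd : ∀ i, g ∣ A.cofactor i ^ 2 := by
    intro i
    obtain ⟨V, c, hc, hV, hdet⟩ := A.exists_det_eq_cofactor_sq_mul i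
    have := hdvd V hV
    rw [hg, hdet, mul_dvd_mul_iff_left A.definingPolynomial_ne_zero] at this
    exact (((isUnit_iff_ne_zero.2 hc).map C).dvd_mul_left).1 this
  have hcof : ∀ i, A.cofactor i ≠ 0 := fun i h =>
    A.definingPolynomial_ne_zero (by rw [← A.linearForm_mul_cofactor i, h, mul_zero])
  have hunit : IsUnit g := by
    by_contra hu
    have hg0 : g ≠ 0 := by
      rintro rfl
      exact pow_ne_zero 2 (hcof ⟨0, hn⟩) (zero_dvd_iff.1 (hg_dvd ⟨0, hn⟩))
    obtain ⟨p, hp, hpg⟩ := WfDvdMonoid.exists_irreducible_factor hu hg0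
    have hpc : ∀ i, p ∣ A.cofactor i := fun i =>
      hp.prime.dvd_of_dvd_pow (hpg.trans (hg_dvd i))
    obtain ⟨k, -, hk⟩ := (hp.prime.dvd_finsetProd_iff _).1 (hpc ⟨0, hn⟩)
    exact A.not_linearForm_dvd_cofactor k
      ((hp.associated_of_dvd (A.irreducible_linearForm k) hk).dvd_iff_dvd_left.1 (hpc k))
  obtain ⟨c, hc, rfl⟩ := isUnit_iff_eq_C_of_isReduced.1 hunit
  exact ⟨M, c, hc.ne_zero, hM, by rw [hg, mul_comm]⟩

/-- Saito's criterion for a free arrangement, in a form that speaks of homogeneous vector fields: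
there are three independent ones whose degrees add up to the number of lines. -/
theorem exists_homogeneous_det_ne_zero (hfree : A.IsFree) (hn : 0 < n) :
    ∃ (M : Matrix (Fin 3) (Fin 3) PolyRing) (d : Fin 3 → ℕ), (∀ k, M k ∈ A.logVectors) ∧
      (∀ k j, (M k j).IsHomogeneous (d k)) ∧ d 0 + d 1 + d 2 = n ∧ M.det ≠ 0 := by
  obtain ⟨M, c, hc, hM, hdet⟩ := A.exists_basis_det hfree hn
  by_contra! hcon
  obtain ⟨N, hN⟩ : ∃ N, ∀ k j, (M k j).totalDegree < N := by
    refine ⟨(Finset.univ.sup fun p : Fin 3 × Fin 3 => (M p.1 p.2).totalDegree) + 1, fun k j => ?_⟩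
    exact Nat.lt_succ_of_le
      (Finset.le_sup (f := fun p : Fin 3 × Fin 3 => (M p.1 p.2).totalDegree) (Finset.mem_univ (k, j)))
  let V : Fin 3 → Fin N → Fin 3 → PolyRing := fun k a j => homogeneousComponent a (M k j)
  have hVhom : ∀ k a j, (V k a j).IsHomogeneous a := fun k a j =>
    homogeneousComponent_isHomogeneous _ _
  have hV : ∀ k a, V k a ∈ A.logVectors := by
    intro k a i
    have h1 : constVec (A.coeff i) ⬝ᵥ V k a =
        homogeneousComponent (a : ℕ) (constVec (A.coeff i) ⬝ᵥ M k) := by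
      simp [dotProduct, V, constVec, homogeneousComponent_C_mul]
    rw [h1]
    exact dvd_homogeneousComponent (linForm_isHomogeneous _) (hM k i) _
  have hsum : M = fun k => ∑ a, V k a := by
    funext k j
    rw [Finset.sum_apply, Fin.sum_univ_eq_sum_range (fun a => homogeneousComponent a (M k j)) N]
    conv_lhs => rw [← sum_homogeneousComponent (M k j)]
    refine Finset.sum_subset (Finset.range_mono (hN k j)) fun a _ ha => ?_
    exact homogeneousComponent_eq_zero _ _ (by simpa using ha)
  have hexp : M.det = ∑ r : Fin 3 → Fin N, Matrix.det fun k => V k (r k) := by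
    conv_lhs => rw [hsum]
    exact (detRowAlternating (R := PolyRing) (n := Fin 3)).toMultilinearMap.map_sum V
  have hdhom : ∀ r : Fin 3 → Fin N, (Matrix.det fun k => V k (r k)).IsHomogeneous
      ((r 0 : ℕ) + r 1 + r 2) := fun r =>
    det_isHomogeneous _ (fun k => (r k : ℕ)) fun k j => hVhom k (r k) j
  -- By multilinearity the determinant is a sum over choices of homogeneous components of the rows.
  -- Its part of degree n is a nonzero multiple of Q, so some choice with degree sum n must
  -- contribute.
  have h0 : homogeneousComponent n M.det = 0 := by
    rw [hexp, map_sum]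
    refine Finset.sum_eq_zero fun r _ => ?_
    rw [homogeneousComponent_of_mem (hdhom r)]
    split_ifs with h
    · exact hcon _ (fun k => (r k : ℕ)) (fun k => hV k (r k)) (fun k j => hVhom k (r k) j) h.symm
    · rfl
  rw [hdet, homogeneousComponent_C_mul, homogeneousComponent_eq_self
    A.definingPolynomial_isHomogeneous] at h0
  exact mul_ne_zero (by simpa using hc) A.definingPolynomial_ne_zero h0

end LineArrangement

/-! ### Radial fields and the non-free arrangements -/

theorem coordVec_ne_zero : coordVec ≠ 0 := fun h => X_ne_zero (R := ℂ) (0 : Fin 3) (congrFun h 0)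

theorem det_eq_zero_of_cross_eq_zero {R : Type*} [CommRing R] (M : Matrix (Fin 3) (Fin 3) R)
    {k l : Fin 3} (hkl : k < l) (h : M k ⨯₃ M l = 0) : M.det = 0 := by
  have h0 := congrFun h 0
  have h1 := congrFun h 1
  have h2 := congrFun h 2
  simp only [cross_apply, cons_val, Pi.zero_apply] at h0 h1 h2
  rw [det_fin_three]
  obtain ⟨rfl, rfl⟩ | ⟨rfl, rfl⟩ | ⟨rfl, rfl⟩ :
      (k = 0 ∧ l = 1) ∨ (k = 0 ∧ l = 2) ∨ (k = 1 ∧ l = 2) := by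
    clear h h0 h1 h2; revert k l; decide
  · linear_combination M 2 0 * h0 + M 2 1 * h1 + M 2 2 * h2
  · linear_combination -M 1 0 * h0 - M 1 1 * h1 - M 1 2 * h2
  · linear_combination M 0 0 * h0 + M 0 1 * h1 + M 0 2 * h2

theorem det_eq_zero_of_forall_dotProduct_eq_zero {R : Type*} [CommRing R] [IsDomain R]
    {m : Type*} [Fintype m] [DecidableEq m] (M : Matrix m m R) {w : m → R} (hw : w ≠ 0)
    (h : ∀ k, w ⬝ᵥ M k = 0) : M.det = 0 :=
  exists_mulVec_eq_zero_iff.1 ⟨w, hw, funext fun k => by rw [mulVec, dotProduct_comm]; exact h k⟩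

theorem cross_coordVec_isHomogeneous {v : Fin 3 → PolyRing} {d : ℕ}
    (hv : ∀ j, (v j).IsHomogeneous d) (m : Fin 3) :
    ((coordVec ⨯₃ v) m).IsHomogeneous (d + 1) := by
  have key : ∀ i j, (coordVec i * v j).IsHomogeneous (d + 1) := fun i j => by
    rw [add_comm]
    exact (isHomogeneous_X ℂ i).mul (hv j)
  fin_cases m <;> exact (key _ _).sub (key _ _)

theorem eval_cross_coordVec (v : Fin 3 → PolyRing) (x : Fin 3 → ℂ) (m : Fin 3) :
    eval x ((coordVec ⨯₃ v) m) = (x ⨯₃ fun j => eval x (v j)) m := by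
  fin_cases m <;> simp [cross_apply, coordVec]

theorem eval_constVec_dotProduct (a : Fin 3 → ℂ) (v : Fin 3 → PolyRing) (x : Fin 3 → ℂ) :
    eval x (constVec a ⬝ᵥ v) = a ⬝ᵥ fun j => eval x (v j) := by
  simp [dotProduct, constVec]

namespace LineArrangement

variable {n : ℕ} {A : LineArrangement n}

theorem dotProduct_eval_eq_zero {v : Fin 3 → PolyRing} (hv : v ∈ A.logVectors) {i : Fin n}
    {x : Fin 3 → ℂ} (hx : A.coeff i ⬝ᵥ x = 0) : (A.coeff i ⬝ᵥ fun j => eval x (v j)) = 0 := by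
  obtain ⟨g, hg⟩ := hv i
  rw [← eval_constVec_dotProduct, hg, map_mul, linearForm_eq, eval_linForm, hx, zero_mul]

/-- A logarithmic vector field of degree `d` is radial along a line that meets the other lines in
more than `d + 1` distinct points. -/
theorem linearForm_dvd_cross {v : Fin 3 → PolyRing} (hv : v ∈ A.logVectors) {d : ℕ}
    (hd : ∀ j, (v j).IsHomogeneous d) {i : Fin n} {S : Finset (Fin n)} (hi : i ∉ S)
    (hS : ∀ j ∈ S, ∀ k ∈ S, j ≠ k → A.coeff i ⬝ᵥ A.coeff j ⨯₃ A.coeff k ≠ 0)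
    (hcard : d + 1 < S.card) (m : Fin 3) : A.linearForm i ∣ (coordVec ⨯₃ v) m := by
  have hne : ∀ j ∈ S, A.coeff i ⨯₃ A.coeff j ≠ 0 := fun j hj =>
    A.cross_coeff_ne_zero fun h => hi (h ▸ hj)
  refine linForm_dvd_of_forall_inter hS hne (A.coeff_ne_zero i) hcard
    (cross_coordVec_isHomogeneous hd m) fun j hj x hix hjx => ?_
  rw [eval_cross_coordVec, cross_eq_zero_of_dotProduct_eq_zero (hne j hj) hix hjx
    (dotProduct_eval_eq_zero hv hix) (dotProduct_eval_eq_zero hv hjx), Pi.zero_apply]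

theorem cross_eq_zero_of_dvd {v : Fin 3 → PolyRing} {d : ℕ}
    (hd : ∀ j, (v j).IsHomogeneous d) {T : Finset (Fin n)} (hcard : d + 1 < T.card)
    (h : ∀ i ∈ T, ∀ m, A.linearForm i ∣ (coordVec ⨯₃ v) m) : coordVec ⨯₃ v = 0 :=
  funext fun m => eq_zero_of_linForm_dvd (a := A.coeff)
    (fun _ _ _ _ hij => A.cross_coeff_ne_zero hij) hcard (cross_coordVec_isHomogeneous hd m)
    fun i hi => h i hi m

/-- A constant divisible by a linear form is zero, so a constant logarithmic field would give a
common point of all the lines. -/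
theorem eq_zero_of_isHomogeneous_zero (hess : A.IsEssential) {v : Fin 3 → PolyRing}
    (hv : v ∈ A.logVectors) (hd : ∀ j, (v j).IsHomogeneous 0) : v = 0 := by
  obtain ⟨c, rfl⟩ : ∃ c, v = constVec c :=
    ⟨fun j => MvPolynomial.coeff 0 (v j), funext fun j =>
      totalDegree_eq_zero_iff_eq_C.1 (Nat.le_zero.1 (hd j).totalDegree_le)⟩
  have h0 : c = 0 := hess c fun i => by
    have h1 : constVec (A.coeff i) ⬝ᵥ constVec c = C (A.coeff i ⬝ᵥ c) := by
      simp [dotProduct, constVec]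
    have h2 : (C (A.coeff i ⬝ᵥ c) : PolyRing) = 0 :=
      eq_zero_of_linForm_dvd (S := {i}) (a := A.coeff) (d := 0)
        (fun _ _ _ _ hij => A.cross_coeff_ne_zero hij) (by simp) (isHomogeneous_C _ _)
        fun j hj => by
          rw [← h1, Finset.mem_singleton.1 hj]
          exact hv i
    exact (C_eq_zero).1 h2
  rw [h0]
  funext j
  simp [constVec]

/-- A generic arrangement of at least four lines is not free. -/
theorem not_isFree_of_generic (hess : A.IsEssential) (hn : 4 ≤ n)
    (hgen : ∀ i j k, i ≠ j → i ≠ k → j ≠ k → A.coeff i ⬝ᵥ A.coeff j ⨯₃ A.coeff k ≠ 0) :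
    ¬ A.IsFree := by
  intro hfree
  obtain ⟨M, d, hM, hd, hsum, hdet⟩ := A.exists_homogeneous_det_ne_zero hfree (by omega)
  have hpos : ∀ k, d k ≠ 0 := by
    intro k hk
    exact hdet (det_eq_zero_of_row_eq_zero k fun j => congrFun
      (eq_zero_of_isHomogeneous_zero hess (hM k) fun j => hk ▸ hd k j) j)
  have hrad : ∀ k, d k + 2 < n → coordVec ⨯₃ M k = 0 := by
    intro k hk
    refine cross_eq_zero_of_dvd (A := A) (hd k) (T := Finset.univ) (by simp; omega)
      fun i _ => linearForm_dvd_cross (hM k) (hd k) (Finset.notMem_erase i Finset.univ) ?_ ?_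
    · exact fun j hj l hl hjl => hgen i j l (Finset.ne_of_mem_erase hj).symm
        (Finset.ne_of_mem_erase hl).symm hjl
    · simp; omega
  -- Hence two of the degrees are at least n - 2 and the third at least 1, with sum at least 2n - 3
  -- > n.
  have hpair : ∀ k l, k < l → ¬(d k + 2 < n ∧ d l + 2 < n) := fun k l hkl ⟨hk, hl⟩ =>
    hdet (det_eq_zero_of_cross_eq_zero M hkl
      (cross_eq_zero_of_cross_eq_zero coordVec_ne_zero (hrad k hk) (hrad l hl)))
  have h0 := hpos 0
  have h1 := hpos 1
  have h2 := hpos 2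
  have h01 := hpair 0 1 (by decide)
  have h02 := hpair 0 2 (by decide)
  have h12 := hpair 1 2 (by decide)
  omega

/-- An arrangement of five lines with exactly one triple point and no points of higher
multiplicity is not free. -/
theorem not_isFree_of_one_triple_point {A : LineArrangement 5} (hess : A.IsEssential)
    {i j k : Fin 5} (hij : i ≠ j) (hik : i ≠ k) (hjk : j ≠ k)
    (hdep : A.coeff i ⬝ᵥ A.coeff j ⨯₃ A.coeff k = 0)
    (hgen : ∀ a b c, a ≠ b → a ≠ c → b ≠ c → a ∉ ({i, j, k} : Finset (Fin 5)) →
      A.coeff a ⬝ᵥ A.coeff b ⨯₃ A.coeff c ≠ 0) :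
    ¬ A.IsFree := by
  intro hfree
  obtain ⟨M, d, hM, hd, hsum, hdet⟩ := A.exists_homogeneous_det_ne_zero hfree (by omega)
  have hpos : ∀ k, d k ≠ 0 := by
    intro k hk
    exact hdet (det_eq_zero_of_row_eq_zero k fun j => congrFun
      (eq_zero_of_isHomogeneous_zero hess (hM k) fun j => hk ▸ hd k j) j)
  have hoff : ∀ r, d r ≤ 2 → ∀ a ∉ ({i, j, k} : Finset (Fin 5)), ∀ m,
      A.linearForm a ∣ (coordVec ⨯₃ M r) m := by
    intro r hr a ha
    refine linearForm_dvd_cross (hM r) (hd r) (Finset.notMem_erase a Finset.univ) ?_ ?_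
    · exact fun b hb c hc hbc => hgen a b c (Finset.ne_of_mem_erase hb).symm
        (Finset.ne_of_mem_erase hc).symm hbc ha
    · simp; omega
  have hrad : ∀ r, d r = 1 → coordVec ⨯₃ M r = 0 := by
    intro r hr
    -- Three lines suffice in degree 1: `i` and the two lines off the triple point. On `i`, omitting
    -- `k` leaves three distinct intersection points.
    refine cross_eq_zero_of_dvd (A := A) (hd r) (T := {j, k}ᶜ) ?_ fun a ha => ?_
    · rw [Finset.card_compl, Finset.card_pair hjk, hr]; decide
    by_cases hai : a = i
    · subst hai
      refine linearForm_dvd_cross (hM r) (hd r) (S := {a, k}ᶜ) (by simp) ?_ ?_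
      · intro b hb c hc hbc
        simp only [Finset.mem_compl, Finset.mem_insert, Finset.mem_singleton, not_or] at hb hc
        by_cases hbj : b = j
        · rw [← triple_product_permutation]
          exact hgen c a b hc.1 hbc.symm (Ne.symm hb.1) (by simp [hc, hbj ▸ hbc.symm])
        · rw [triple_product_permutation]
          exact hgen b c a hbc hb.1 hc.1 (by simp [hb, hbj])
      · rw [Finset.card_compl, Finset.card_pair hik, hr]; decide
    · refine hoff r (by omega) a ?_
      simp only [Finset.mem_compl, Finset.mem_insert, Finset.mem_singleton, not_or] at ha ⊢
      exact ⟨hai, ha⟩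
  set p := A.coeff i ⨯₃ A.coeff j with hp
  have hp0 : p ≠ 0 := A.cross_coeff_ne_zero hij
  have hpl : ∀ a ∈ ({i, j, k} : Finset (Fin 5)), A.coeff a ⬝ᵥ p = 0 := by
    intro a ha
    simp only [Finset.mem_insert, Finset.mem_singleton] at ha
    obtain rfl | rfl | rfl := ha
    · simp [hp]
    · simp [hp]
    · rw [hp, triple_product_permutation, hdep]
  -- This form has degree at most 3 and is divisible by all five linear forms. Off the triple point,
  -- each line has four intersection points. For a line through `p`, the form is the determinant of
  -- `p`, (x, y, z) and the field, all tangent to that line.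
  have hperp : ∀ r, d r ≤ 2 → constVec p ⬝ᵥ coordVec ⨯₃ M r = 0 := by
    intro r hr
    refine eq_zero_of_linForm_dvd (S := Finset.univ) (a := A.coeff) (d := d r + 1)
      (fun _ _ _ _ hij => A.cross_coeff_ne_zero hij) (by simp; omega) ?_ fun a _ => ?_
    · refine IsHomogeneous.sum _ _ _ fun m _ => ?_
      exact (cross_coordVec_isHomogeneous (hd r) m).C_mul _
    by_cases ha : a ∈ ({i, j, k} : Finset (Fin 5))
    · rw [triple_product_eq_det]
      refine linForm_dvd_det (A.coeff_ne_zero a) _ fun l => ?_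
      fin_cases l
      · have : constVec (A.coeff a) ⬝ᵥ constVec p = C (A.coeff a ⬝ᵥ p) := by
          simp [dotProduct, constVec]
        simp [this, hpl a ha]
      · exact dvd_rfl
      · exact hM r a
    · exact Finset.dvd_sum fun m _ => (hoff r hr a ha m).mul_left _
  have hpair : ∀ r s, r < s → ¬(d r = 1 ∧ d s = 1) := fun r s hrs ⟨hr, hs⟩ =>
    hdet (det_eq_zero_of_cross_eq_zero M hrs
      (cross_eq_zero_of_cross_eq_zero coordVec_ne_zero (hrad r hr) (hrad s hs)))
  have hall : ¬ ∀ r, d r ≤ 2 := by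
    intro hle
    refine hdet (det_eq_zero_of_forall_dotProduct_eq_zero M (w := constVec p ⨯₃ coordVec) ?_
      fun r => ?_)
    · intro h0
      have hx : ∀ x, p ⨯₃ x = 0 := fun x => funext fun m => by
        have := congrArg (fun w : Fin 3 → PolyRing => eval x (w m)) h0
        fin_cases m <;> simpa [cross_apply, constVec, coordVec] using this
      have := cross_eq_zero_of_cross_eq_zero hp0 (hx ![1, 0, 0]) (hx ![0, 1, 0])
      simpa [cross_apply] using congrFun this 2
    · rw [dotProduct_comm, triple_product_permutation]
      exact hperp r (hle r)
  have h0 := hpos 0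
  have h1 := hpos 1
  have h2 := hpos 2
  have h01 := hpair 0 1 (by decide)
  have h02 := hpair 0 2 (by decide)
  have h12 := hpair 1 2 (by decide)
  -- Positive degrees with sum 5, at most one of them equal to 1, are 1, 2, 2 in some order.
  apply hall
  intro r
  fin_cases r <;> simp only [Fin.zero_eta, Fin.mk_one, Fin.reduceFinMk] <;> omega

end LineArrangement

/-! ### Bounding the degree by counting intersection points -/

/-- If the Hilbert function is bounded, then the Hilbert polynomial is a constant, which is at most
the bound. -/
theorem idealDegree_le {I : Ideal PolyRing} {s : ℕ} (h : ∀ k, hilbertFunction I k ≤ s) :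
    idealDegree I ≤ s := by
  by_cases hex : ∃ P, IsHilbertPolynomial I P
  · have hP : IsHilbertPolynomial I (hilbertPolynomial I) := by
      rw [hilbertPolynomial, dif_pos hex]
      exact hex.choose_spec
    set P := hilbertPolynomial I with hPdef
    obtain ⟨N, hN⟩ := Filter.eventually_atTop.1 hP
    -- A bounded function takes some value infinitely often, and a polynomial that does so is
    -- constant.
    obtain ⟨c, hc, hinf⟩ : ∃ c ∈ Set.Iic s, (hilbertFunction I ⁻¹' {c}).Infinite := by
      by_contra! hfin
      have : (hilbertFunction I ⁻¹' Set.Iic s).Finite := by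
        rw [← Set.biUnion_preimage_singleton]
        exact (Set.finite_Iic s).biUnion fun c hc => hfin c hc
      have huniv : hilbertFunction I ⁻¹' Set.Iic s = Set.univ := Set.eq_univ_of_forall h
      exact Set.infinite_univ (huniv ▸ this)
    have hPc : P = Polynomial.C (c : ℚ) := by
      refine Polynomial.eq_of_infinite_eval_eq _ _ (Set.Infinite.mono ?_
        ((hinf.sdiff (Set.finite_Iio N)).image (Nat.cast_injective (R := ℚ)).injOn))
      rintro _ ⟨k, ⟨hk, hkN⟩, rfl⟩
      have hk' : hilbertFunction I k = c := hk
      have := hN k (not_lt.1 hkN)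
      rw [hk'] at this
      simpa using this.symm
    rw [idealDegree, ← hPdef, hPc]
    simpa [Polynomial.leadingCoeff_C, -map_natCast] using hc
  -- Without a Hilbert polynomial the degree is 0 by convention, and the bound is trivial.
  · rw [idealDegree, hilbertPolynomial, dif_neg hex]
    simp

/-- If all the forms of degree `k` that vanish in finitely many given points belong to `I`, then
the Hilbert function of `R / I` in degree `k` is at most the number of the points. -/
theorem hilbertFunction_le {I : Ideal PolyRing} {τ : Type*} [Fintype τ] (p : τ → Fin 3 → ℂ) (k : ℕ)
    (h : ∀ f : PolyRing, f.IsHomogeneous k → (∀ t, eval (p t) f = 0) → f ∈ I) :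
    hilbertFunction I k ≤ Fintype.card τ := by
  let ev : homogeneousSubmodule (Fin 3) ℂ k →ₗ[ℂ] τ → ℂ :=
    (LinearMap.pi fun t => (aeval (p t)).toLinearMap) ∘ₗ Submodule.subtype _
  have hker : LinearMap.ker ev ≤
      (I.restrictScalars ℂ).comap (homogeneousSubmodule (Fin 3) ℂ k).subtype := by
    intro f hf
    refine h f.1 f.2 fun t => ?_
    have := congrFun (LinearMap.mem_ker.1 hf) t
    simpa [ev, aeval_eq_eval] using this
  have hfin : Module.Finite ℂ (homogeneousSubmodule (Fin 3) ℂ k ⧸ LinearMap.ker ev) :=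
    Module.Finite.equiv ev.quotKerEquivRange.symm
  calc hilbertFunction I k
      ≤ Module.finrank ℂ (homogeneousSubmodule (Fin 3) ℂ k ⧸ LinearMap.ker ev) :=
        LinearMap.finrank_le_finrank_of_surjective (Submodule.factor_surjective hker)
    _ = Module.finrank ℂ (LinearMap.range ev) := ev.quotKerEquivRange.finrank_eq
    _ ≤ Module.finrank ℂ (τ → ℂ) := Submodule.finrank_le _
    _ = Fintype.card τ := Module.finrank_fintype_fun_eq_card ℂ

theorem eval_smul_of_isHomogeneous {f : PolyRing} {k : ℕ} (hf : f.IsHomogeneous k) (c : ℂ)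
    (x : Fin 3 → ℂ) : eval (c • x) f = c ^ k * eval x f := by
  rw [eval_eq, eval_eq, Finset.mul_sum]
  refine Finset.sum_congr rfl fun m hm => ?_
  have hk : c ^ k = ∏ i ∈ m.support, c ^ m i := by
    rw [Finset.prod_pow_eq_pow_sum, hf.degree_eq_sum_deg_support hm]
  simp only [Pi.smul_apply, smul_eq_mul, mul_pow, Finset.prod_mul_distrib, hk]
  ring

theorem exists_eq_smul_cross {a b x : Fin 3 → ℂ} (h : a ⨯₃ b ≠ 0) (ha : a ⬝ᵥ x = 0)
    (hb : b ⬝ᵥ x = 0) : ∃ c : ℂ, x = c • a ⨯₃ b := by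
  have h0 := cross_eq_zero_of_dotProduct_eq_zero h (dot_self_cross a b) (dot_cross_self a b) ha hb
  by_contra! hc
  refine (crossProduct_ne_zero_iff_linearIndependent.2 ?_) h0
  rw [LinearIndependent.pair_iff' h]
  exact fun c hx => hc c hx.symm

theorem dotProduct_eq_zero_of_dependent {a b c x : Fin 3 → ℂ} (h : a ⨯₃ b ≠ 0)
    (hdep : c ⬝ᵥ a ⨯₃ b = 0) (ha : a ⬝ᵥ x = 0) (hb : b ⬝ᵥ x = 0) : c ⬝ᵥ x = 0 := by
  obtain ⟨r, rfl⟩ := exists_eq_smul_cross h ha hb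
  rw [dotProduct_smul, hdep, smul_zero]

namespace LineArrangement

variable {n : ℕ} (A : LineArrangement n)

/-- The singular points of an arrangement lie on two of its lines. -/
theorem exists_pair_of_mem_zeroLocus (hn : 0 < n) {x : Fin 3 → ℂ}
    (hx : x ∈ zeroLocus ℂ A.jacobianIdeal) :
    ∃ i j, i ≠ j ∧ A.coeff i ⬝ᵥ x = 0 ∧ A.coeff j ⬝ᵥ x = 0 := by
  have hder : ∀ m, eval x (pderiv m A.definingPolynomial) = 0 := fun m => by
    simpa [aeval_eq_eval] using hx _ (Ideal.subset_span ⟨m, rfl⟩)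
  -- Euler's formula: n·Q is a combination of the partial derivatives.
  have hQ : eval x A.definingPolynomial = 0 := by
    have := congrArg (eval x) A.definingPolynomial_isHomogeneous.sum_X_mul_pderiv
    simpa [hder, hn.ne'] using this.symm
  rw [definingPolynomial, map_prod, Finset.prod_eq_zero_iff] at hQ
  obtain ⟨i, -, hi⟩ := hQ
  -- At a zero of L_i the m-th partial derivative of Q is the m-th coefficient of L_i times the
  -- cofactor.
  have hcof : eval x (A.cofactor i) = 0 := by
    obtain ⟨m, hm⟩ := Function.ne_iff.1 (A.coeff_ne_zero i)
    have h1 := hder m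
    rw [← A.linearForm_mul_cofactor i, Derivation.leibniz, A.derivation_linearForm] at h1
    have h2 : (constVec (A.coeff i) ⬝ᵥ fun j => pderiv m (X j : PolyRing)) = C (A.coeff i m) := by
      simp [dotProduct, constVec, pderiv_X, Pi.single_apply]
    rw [h2] at h1
    have hm' : A.coeff i m ≠ 0 := hm
    simpa [hi, hm'] using h1
  rw [cofactor, map_prod, Finset.prod_eq_zero_iff] at hcof
  obtain ⟨j, hj, hjx⟩ := hcof
  exact ⟨i, j, (Finset.ne_of_mem_erase hj).symm, by simpa [linearForm_eq] using hi,
    by simpa [linearForm_eq] using hjx⟩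

/-- Indexing by unordered pairs makes the number of points a binomial coefficient; diagonal pairs
get an irrelevant point. -/
theorem exists_intersection_point (z : Sym2 (Fin n)) :
    ∃ p : Fin 3 → ℂ, ∀ a b, a ≠ b → z = s(a, b) → ∀ x, A.coeff a ⬝ᵥ x = 0 → A.coeff b ⬝ᵥ x = 0 →
      ∃ c : ℂ, x = c • p := by
  induction z with
  | _ i j =>
    refine ⟨A.coeff i ⨯₃ A.coeff j, fun a b hab h x ha hb => ?_⟩
    obtain ⟨rfl, rfl⟩ | ⟨rfl, rfl⟩ := Sym2.eq_iff.1 h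
    · exact exists_eq_smul_cross (A.cross_coeff_ne_zero hab) ha hb
    · exact exists_eq_smul_cross (A.cross_coeff_ne_zero hab.symm) hb ha

/-- The degree of the radical of the Jacobian ideal is at most the number of pairs of lines minus
the number of pairs in `B`, if every intersection of two lines is the intersection of a pair of
lines not in `B`. -/
theorem idealDegree_radical_le (hn : 0 < n) (B : Finset (Sym2 (Fin n))) {r : ℕ} (hr : B.card = r)
    (hBd : ∀ z ∈ B, ¬ z.IsDiag)
    (hB : ∀ i j, i ≠ j → s(i, j) ∈ B → ∃ a b, a ≠ b ∧ s(a, b) ∉ B ∧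
      ∀ x, A.coeff i ⬝ᵥ x = 0 → A.coeff j ⬝ᵥ x = 0 → A.coeff a ⬝ᵥ x = 0 ∧ A.coeff b ⬝ᵥ x = 0) :
    idealDegree A.jacobianIdeal.radical ≤ (n.choose 2 - r : ℕ) := by
  classical
  subst hr
  let T : Finset (Sym2 (Fin n)) := Finset.univ.filter (fun z => ¬ z.IsDiag) \ B
  have hTcard : T.card = n.choose 2 - B.card := by
    rw [Finset.card_sdiff_of_subset fun z hz => by simpa using hBd z hz, ← Fintype.card_subtype,
      Sym2.card_subtype_not_diag, Fintype.card_fin]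
  have hT : ∀ i j, i ≠ j → ∃ a b, a ≠ b ∧ s(a, b) ∈ T ∧
      ∀ x, A.coeff i ⬝ᵥ x = 0 → A.coeff j ⬝ᵥ x = 0 →
        A.coeff a ⬝ᵥ x = 0 ∧ A.coeff b ⬝ᵥ x = 0 := by
    intro i j hij
    by_cases h : s(i, j) ∈ B
    · obtain ⟨a, b, hab, habB, hx⟩ := hB i j hij h
      exact ⟨a, b, hab, by simp [T, hab, habB], hx⟩
    · exact ⟨i, j, hij, by simp [T, hij, h], fun x hi hj => ⟨hi, hj⟩⟩
  choose p hp using A.exists_intersection_point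
  have hpt : ∀ i j, i ≠ j → ∀ x, A.coeff i ⬝ᵥ x = 0 → A.coeff j ⬝ᵥ x = 0 →
      ∃ (t : T) (c : ℂ), x = c • p t := by
    intro i j hij x hi hj
    obtain ⟨a, b, hab, hmem, hx⟩ := hT i j hij
    exact ⟨⟨_, hmem⟩, hp _ a b hab rfl x (hx x hi hj).1 (hx x hi hj).2⟩
  rw [← hTcard]
  refine idealDegree_le fun k => ?_
  rw [← Fintype.card_coe T]
  refine hilbertFunction_le (fun t : T => p t) k fun f hf hft => ?_
  rw [← vanishingIdeal_zeroLocus_eq_radical (K := ℂ), mem_vanishingIdeal_iff]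
  intro x hx
  obtain ⟨i, j, hij, hi, hj⟩ := A.exists_pair_of_mem_zeroLocus hn hx
  obtain ⟨t, c, rfl⟩ := hpt i j hij x hi hj
  rw [aeval_eq_eval, eval_smul_of_isHomogeneous hf, hft, mul_zero]

theorem idealDegree_radical_le_choose (hn : 0 < n) :
    idealDegree A.jacobianIdeal.radical ≤ (n.choose 2 : ℕ) := by
  simpa using A.idealDegree_radical_le hn ∅ rfl (by simp) (by simp)

variable {A} in
theorem concurrent_of_dependent {i j k : Fin n} (hij : i ≠ j) (hik : i ≠ k) (hjk : j ≠ k)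
    (hdep : A.coeff i ⬝ᵥ A.coeff j ⨯₃ A.coeff k = 0) (x : Fin 3 → ℂ) :
    (A.coeff i ⬝ᵥ x = 0 → A.coeff j ⬝ᵥ x = 0 → A.coeff k ⬝ᵥ x = 0) ∧
    (A.coeff i ⬝ᵥ x = 0 → A.coeff k ⬝ᵥ x = 0 → A.coeff j ⬝ᵥ x = 0) ∧
    (A.coeff j ⬝ᵥ x = 0 → A.coeff k ⬝ᵥ x = 0 → A.coeff i ⬝ᵥ x = 0) := by
  have hdep' := hdep
  rw [triple_product_permutation] at hdep'
  have hdep'' := hdep'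
  rw [triple_product_permutation] at hdep''
  exact ⟨dotProduct_eq_zero_of_dependent (A.cross_coeff_ne_zero hij) hdep'',
    fun hi hk => dotProduct_eq_zero_of_dependent (A.cross_coeff_ne_zero hik.symm) hdep' hk hi,
    dotProduct_eq_zero_of_dependent (A.cross_coeff_ne_zero hjk) hdep⟩

/-- The triple point is represented by the pair `i`, `j`; the other two pairs are redundant. -/
theorem idealDegree_radical_le_of_triple (hn : 0 < n) {i j k : Fin n} (hij : i ≠ j) (hik : i ≠ k)
    (hjk : j ≠ k) (hdep : A.coeff i ⬝ᵥ A.coeff j ⨯₃ A.coeff k = 0) :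
    idealDegree A.jacobianIdeal.radical ≤ (n.choose 2 - 2 : ℕ) := by
  have hcard : ({s(i, k), s(j, k)} : Finset (Sym2 (Fin n))).card = 2 :=
    Finset.card_pair (by simp [hij, hik])
  refine A.idealDegree_radical_le hn _ hcard (by simp [hik, hjk]) fun p q _ hmem =>
    ⟨i, j, hij, by simp [hij, hik, hjk], fun x hp hq => ?_⟩
  obtain ⟨-, h1, h2⟩ := concurrent_of_dependent hij hik hjk hdep x
  simp only [Finset.mem_insert, Finset.mem_singleton, Sym2.eq_iff] at hmem
  obtain (⟨rfl, rfl⟩ | ⟨rfl, rfl⟩) | (⟨rfl, rfl⟩ | ⟨rfl, rfl⟩) := hmem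
  · exact ⟨hp, h1 hp hq⟩
  · exact ⟨hq, h1 hq hp⟩
  · exact ⟨h2 hp hq, hp⟩
  · exact ⟨h2 hq hp, hq⟩

/-- Since `a` lies outside the first triple, the pair `a`, `b` is a third redundant one, represented
by `a`, `c`. The two triples may share lines or even their point. -/
theorem idealDegree_radical_le_of_two_triples (hn : 0 < n) {i j k a b c : Fin n} (hij : i ≠ j)
    (hik : i ≠ k) (hjk : j ≠ k) (hdep : A.coeff i ⬝ᵥ A.coeff j ⨯₃ A.coeff k = 0)
    (hab : a ≠ b) (hac : a ≠ c) (hbc : b ≠ c) (ha : a ∉ ({i, j, k} : Finset (Fin n)))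
    (hdep' : A.coeff a ⬝ᵥ A.coeff b ⨯₃ A.coeff c = 0) :
    idealDegree A.jacobianIdeal.radical ≤ (n.choose 2 - 3 : ℕ) := by
  simp only [Finset.mem_insert, Finset.mem_singleton, not_or] at ha
  obtain ⟨hai, haj, hak⟩ := ha
  have hcard : ({s(i, k), s(j, k), s(a, b)} : Finset (Sym2 (Fin n))).card = 3 := by
    rw [Finset.card_eq_three]
    refine ⟨_, _, _, ?_, ?_, ?_, rfl⟩
    · simp [hij, hik]
    · simp [Ne.symm hai, Ne.symm hak]
    · simp [Ne.symm haj, Ne.symm hak]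
  refine A.idealDegree_radical_le hn _ hcard (by simp [hik, hjk, hab]) fun p q _ hmem => ?_
  simp only [Finset.mem_insert, Finset.mem_singleton] at hmem
  rw [← or_assoc] at hmem
  obtain hmem | hmem := hmem
  · refine ⟨i, j, hij, by simp [hij, hik, hjk, Ne.symm hai, Ne.symm haj], fun x hp hq => ?_⟩
    obtain ⟨-, h1, h2⟩ := concurrent_of_dependent hij hik hjk hdep x
    simp only [Sym2.eq_iff] at hmem
    obtain (⟨rfl, rfl⟩ | ⟨rfl, rfl⟩) | (⟨rfl, rfl⟩ | ⟨rfl, rfl⟩) := hmem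
    · exact ⟨hp, h1 hp hq⟩
    · exact ⟨hq, h1 hq hp⟩
    · exact ⟨h2 hp hq, hp⟩
    · exact ⟨h2 hq hp, hq⟩
  · refine ⟨a, c, hac, by simp [hai, haj, hak, Ne.symm hbc, hab], fun x hp hq => ?_⟩
    obtain ⟨h1, -, -⟩ := concurrent_of_dependent hab hac hbc hdep' x
    obtain ⟨rfl, rfl⟩ | ⟨rfl, rfl⟩ := Sym2.eq_iff.1 hmem
    · exact ⟨hp, h1 hp hq⟩
    · exact ⟨hq, h1 hq hp⟩

/-! ### Pencils and arrangements of few lines -/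

variable {A} in
/-- If all lines but one pass through a point, then an essential arrangement is a pencil plus a
generic line. -/
theorem isPencilPlusGenericLine_of_forall (hess : A.IsEssential) {p : Fin 3 → ℂ} (hp : p ≠ 0)
    (l : Fin n) (h : ∀ m, m ≠ l → A.PassesThrough m p) : A.IsPencilPlusGenericLine := by
  refine ⟨p, l, hp, fun hl => hp (hess p fun m => ?_), h⟩
  by_cases hm : m = l
  · exact hm ▸ hl
  · exact h m hm

variable {A} in
theorem four_le_of_not_isPencilPlusGenericLine (hess : A.IsEssential)
    (hpencil : ¬ A.IsPencilPlusGenericLine) : 4 ≤ n := by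
  by_contra! hn
  have key : ∃ p : Fin 3 → ℂ, p ≠ 0 ∧ ∀ m : Fin n, (m : ℕ) ≠ 0 → A.PassesThrough m p := by
    -- Row 0 is left zero, so `M` is singular, and a kernel vector is a common point of all lines
    -- but the first.
    let M : Matrix (Fin 3) (Fin 3) ℂ :=
      Matrix.of fun r => if h : r ≠ 0 ∧ (r : ℕ) < n then A.coeff ⟨r, h.2⟩ else 0
    have hM : M.det = 0 := det_eq_zero_of_row_eq_zero 0 fun j => by simp [M]
    obtain ⟨p, hp, hMp⟩ := exists_mulVec_eq_zero_iff.2 hM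
    refine ⟨p, hp, fun m hm => ?_⟩
    have h0 : (⟨m, by omega⟩ : Fin 3) ≠ 0 := fun h => hm (congrArg Fin.val h)
    have := congrFun hMp ⟨m, by omega⟩
    have hsum : ∑ j, A.coeff m j * p j = 0 := by simpa [M, mulVec, h0, dotProduct] using this
    exact hsum
  obtain ⟨p, hp, hall⟩ := key
  by_cases hn0 : n = 0
  · exact hp (hess p fun m => absurd m.2 (by omega))
  · refine hpencil (isPencilPlusGenericLine_of_forall hess hp ⟨0, by omega⟩ fun m hm => hall m ?_)
    exact fun h => hm (Fin.ext h)

theorem generic_of_four_lines {A : LineArrangement 4} (hess : A.IsEssential)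
    (hpencil : ¬ A.IsPencilPlusGenericLine) {i j k : Fin 4} (hij : i ≠ j) (hik : i ≠ k)
    (hjk : j ≠ k) : A.coeff i ⬝ᵥ A.coeff j ⨯₃ A.coeff k ≠ 0 := by
  intro hdep
  obtain ⟨l, hl⟩ : ∃ l, ∀ m, m ≠ l → m = i ∨ m = j ∨ m = k := by
    clear hdep
    revert i j k; decide
  refine hpencil (isPencilPlusGenericLine_of_forall hess (A.cross_coeff_ne_zero hjk) l
    fun m hm => ?_)
  obtain rfl | rfl | rfl := hl m hm
  · exact hdep
  · exact dot_self_cross _ _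
  · exact dot_cross_self _ _

end LineArrangement

/-! ### Reduction to four, five or six lines -/

theorem corollary3p5 {n : ℕ} (A : LineArrangement n) (hess : A.IsEssential)
    (hpencil : ¬ A.IsPencilPlusGenericLine)
    (hdeg : idealDegree A.jacobianIdeal.radical ≥ (n : ℚ) ^ 2 - 5 * (n : ℚ) + 8) :
    ¬ A.IsFree := by
  have hn := LineArrangement.four_le_of_not_isPencilPlusGenericLine hess hpencil
  have hn0 : 0 < n := by omega
  have hbound : ∀ b : ℕ, idealDegree A.jacobianIdeal.radical ≤ b → n ^ 2 + 8 ≤ b + 5 * n := by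
    intro b hb
    have : (n : ℚ) ^ 2 + 8 ≤ b + 5 * n := by linarith
    exact_mod_cast this
  have hchoose := hbound _ (A.idealDegree_radical_le_choose hn0)
  -- The inequality says n² - 9n + 16 ≤ 0, which fails from n = 7 on.
  have hn6 : n ≤ 6 := by
    by_contra! h
    have h2 := Nat.choose_two_right n
    have h3 : n.choose 2 * 2 ≤ n * (n - 1) := by rw [h2]; exact Nat.div_mul_le_self _ _
    obtain ⟨m, rfl⟩ := Nat.exists_eq_add_of_le' h
    simp only [Nat.add_succ_sub_one] at h3
    nlinarith
  by_cases hgen : ∀ i j k, i ≠ j → i ≠ k → j ≠ k → A.coeff i ⬝ᵥ A.coeff j ⨯₃ A.coeff k ≠ 0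
  · exact LineArrangement.not_isFree_of_generic hess hn hgen
  push Not at hgen
  obtain ⟨i, j, k, hij, hik, hjk, hdep⟩ := hgen
  have htriple := hbound _ (A.idealDegree_radical_le_of_triple hn0 hij hik hjk hdep)
  obtain rfl | rfl | rfl : n = 4 ∨ n = 5 ∨ n = 6 := by omega
  · exact absurd hdep (LineArrangement.generic_of_four_lines hess hpencil hij hik hjk)
  · refine LineArrangement.not_isFree_of_one_triple_point hess hij hik hjk hdep
      fun a b c hab hac hbc ha hdep' => ?_
    -- A second dependent triple would leave at most 7 points where 8 are required.
    have := hbound _ (A.idealDegree_radical_le_of_two_triples hn0 hij hik hjk hdep hab hac hbc ha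
      hdep')
    simp [Nat.choose] at this
  -- A triple point leaves at most 13 points where 14 are required.
  · simp [Nat.choose] at htriple
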